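/- Let $p$ be an odd prime and let $0<\alpha\le 1$. For a finite-dimensional vector space $V$ over $\mathbb F_p$ and a function $f:V\to\mathbb R$ put $$\mathbb E(f)=|V|^{-1}\sum_{m\in V}f(m),\qquad \Lambda_3(f)=|V|^{-2}\sum_{m,d\in V}f(m)f(m+d)f(m+2d).$$ There are functions $c,\delta:\mathbb N\to\mathbb R$, depending only on $p$ and $\alpha$, with $c(n)=o(n)$ and $\delta(n)=o(1)$ as $n\to\infty$, such that the following holds for every $n\ge 0$ and every $n$-dimensional vector space $V$ over $\mathbb F_p$ (in particular for $V=\mathbb F_{p^n}$, $n\ge1$). Suppose that $f:V\to[0,1]$ satisfies $\mathbb E(f)\ge\alpha$ and that $\Lambda_3(f)\le\Lambda_3(g)$ for every $g:V\to[0,1]$ with $\mathbb E(g)\ge\alpha$. Then there are a subspace $W\le V$ with $\dim W\ge n-c(n)$ and a function $h:V\to\{0,1\}$ that is constant on cosets of $W$ (that is, $h(a+w)=h(a)$ for all $a\in V$, $w\in W$), such that $$\mathbb E(|f-h|)\le\delta(n).$$ -/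

import Mathlib

namespace ThreeAP

/-- The mean `E(f) = |V|⁻¹ ∑ₘ f(m)` of a real function on a finite set. -/
noncomputable def mean {V : Type*} [Fintype V] (f : V → ℝ) : ℝ :=
  (Fintype.card V : ℝ)⁻¹ * ∑ m, f m

/-- The normalized count of three-term progressions,
`Λ₃(f) = |V|⁻² ∑_{m,d} f(m) f(m+d) f(m+2d)`; the trivial ones (`d = 0`) are included. -/
noncomputable def lambda3 {V : Type*} [AddCommGroup V] [Fintype V] (f : V → ℝ) : ℝ :=
  ((Fintype.card V : ℝ) ^ 2)⁻¹ * ∑ m, ∑ d, f m * f (m + d) * f (m + 2 • d)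

/-- `f : V → [0,1]` with `E(f) ≥ α`. -/
def Admissible {V : Type*} [Fintype V] (α : ℝ) (f : V → ℝ) : Prop :=
  (∀ m, f m ∈ Set.Icc (0 : ℝ) 1) ∧ α ≤ mean f

/-- `f : V → [0,1]` minimises `Λ₃` among all functions `V → [0,1]` of mean at least `α`. -/
def IsMinimiser {V : Type*} [AddCommGroup V] [Fintype V] (α : ℝ) (f : V → ℝ) : Prop :=
  Admissible α f ∧ ∀ g : V → ℝ, Admissible α g → lambda3 f ≤ lambda3 g

end ThreeAP

namespace ThreeAP

/-! Let `f` be a minimiser. By Parseval only boundedly many Fourier coefficients of `f` exceed ε, so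
they all live on the annihilator of a subspace W of bounded codimension. Since Λ₃(f) = ∑ f̂(l)²
f̂(-2l), replacing `f` by its average F over cosets of W discards only terms with a factor of size
at most ε, and Λ₃ rises by at most ε (`lambda3_cosetAverage_le`).

If F were far from {0, 1}, the room t = min(F, 1 - F) would have mean at least δ, hence Λ₃(t) ≥ κ by
Varnavides (`exists_pos_le_lambda3`). For a functional l that is nonzero on W, the function F + t
(1/p - 1_{l = 0}) still takes values in [0, 1] and has the same mean, while its Λ₃ is lower than
that of F by exactly p⁻²(1 - 1/p) Λ₃(t) (`lambda3_add_mul_balancedPoint`). For small ε this beats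
`f`, a contradiction. So F is nearly 0-1 valued, and rounding it gives h.

The codimension bound depends only on p and δ, so δ may tend to 0 slowly with n. -/

open Finset
open Module (Dual)

/-! ### Roth's theorem for weights -/

/-- Averaging over the domain of a surjective homomorphism is averaging over its codomain. -/
lemma card_mul_sum_comp_of_surjective {A B : Type*} [AddCommGroup A] [Fintype A]
    [AddCommGroup B] [Fintype B] (φ : A →+ B) (hφ : Function.Surjective φ) (H : B → ℝ) :
    (Fintype.card B : ℝ) * ∑ a, H (φ a) = Fintype.card A * ∑ b, H b := by
  have h1 : ∑ b : B, ∑ a, H (φ a + b) = Fintype.card A * ∑ b, H b := by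
    rw [sum_comm]
    have : ∀ a : A, ∑ b, H (φ a + b) = ∑ b, H b := fun a ↦
      Equiv.sum_comp (Equiv.addLeft (φ a)) H
    simp [this]
  have h2 : ∑ b : B, ∑ a, H (φ a + b) = Fintype.card B * ∑ a, H (φ a) := by
    have : ∀ b : B, ∑ a, H (φ a + b) = ∑ a, H (φ a) := fun b ↦ by
      obtain ⟨c, rfl⟩ := hφ b
      simp_rw [← map_add]
      exact Equiv.sum_comp (Equiv.addRight c) (fun a ↦ H (φ a))
    simp [this]
  rw [← h1, h2]

/-- A linear form of Roth's theorem: a function of mean at least `2 η` weighs some nontrivial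
progression by at least `η ^ 3`. -/
lemma pow_three_mul_le_sum_nontrivial {U : Type*} [AddCommGroup U] [Fintype U] [DecidableEq U]
    {η : ℝ} (hη : 0 < η) (hU : cornersTheoremBound η ≤ Fintype.card U)
    (s : U → ℝ) (hs : ∀ x, s x ∈ Set.Icc (0 : ℝ) 1) :
    η ^ 3 * (mean s - 2 * η) ≤
      ∑ d ∈ univ.filter (· ≠ (0 : U)), ∑ x, s x * s (x + d) * s (x + 2 • d) := by
  have hnn : ∀ d x, 0 ≤ s x * s (x + d) * s (x + 2 • d) := fun d x ↦
    mul_nonneg (mul_nonneg (hs _).1 (hs _).1) (hs _).1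
  have hcard : (0 : ℝ) < Fintype.card U := by exact_mod_cast Fintype.card_pos
  -- For small mean the left side is nonpositive. Linearity in `mean s` lets the bound be summed
  -- over many `s` without separating sparse ones.
  rcases lt_or_ge (mean s) (2 * η) with h | h
  · refine le_trans (mul_nonpos_of_nonneg_of_nonpos (by positivity) (by linarith)) ?_
    exact sum_nonneg fun d _ ↦ sum_nonneg fun x _ ↦ hnn d x
  · have hmean : mean s ≤ 1 := by
      unfold mean
      rw [inv_mul_le_iff₀ hcard]
      calc ∑ m, s m ≤ ∑ _m : U, (1 : ℝ) := sum_le_sum fun m _ ↦ (hs m).2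
        _ = _ := by simp
    let A : Finset U := univ.filter fun x ↦ η ≤ s x
    have hA : η * Fintype.card U ≤ #A := by
      have h1 : ∑ m, s m ≤ ∑ m, ((if η ≤ s m then 1 else 0) + η) := by
        refine sum_le_sum fun m _ ↦ ?_
        split_ifs with hm
        · linarith [(hs m).2]
        · linarith
      rw [sum_add_distrib, sum_boole] at h1
      simp only [sum_const, card_univ, nsmul_eq_mul] at h1
      have h2 : 2 * η * Fintype.card U ≤ ∑ m, s m := by
        unfold mean at h
        rwa [le_inv_mul_iff₀ hcard, mul_comm] at h
      change _ ≤ ((#(univ.filter fun x ↦ η ≤ s x) : ℕ) : ℝ)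
      linarith
    have hAP := roth_3ap_theorem η hη hU A hA
    simp only [ThreeAPFree, not_forall] at hAP
    obtain ⟨a, ha, b, hb, c, hc, habc, hne⟩ := hAP
    have hc' : a + 2 • (b - a) = c := by
      have : c = b + b - a := by rw [← habc]; abel
      rw [this]; abel
    have hb' : a + (b - a) = b := by abel
    have hmem : ∀ x ∈ (A : Set U), η ≤ s x := fun x hx ↦ by simpa [A] using hx
    calc η ^ 3 * (mean s - 2 * η) ≤ η ^ 3 * 1 := by gcongr; linarith
      _ = η * η * η := by ring
      _ ≤ s a * s (a + (b - a)) * s (a + 2 • (b - a)) := by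
        rw [hc', hb']
        have := hmem a ha; have := hmem b hb; have := hmem c hc
        have := (hs a).1; have := (hs b).1
        gcongr
      _ ≤ ∑ x, s x * s (x + (b - a)) * s (x + 2 • (b - a)) :=
        single_le_sum (f := fun x ↦ s x * s (x + (b - a)) * s (x + 2 • (b - a)))
          (fun x _ ↦ hnn _ x) (mem_univ a)
      _ ≤ _ := single_le_sum
          (f := fun d ↦ ∑ x, s x * s (x + d) * s (x + 2 • d))
          (fun d _ ↦ sum_nonneg fun x _ ↦ hnn _ x)
          (mem_filter.2 ⟨mem_univ _, sub_ne_zero.2 fun h ↦ hne h.symm⟩)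

/-! ### Averages over cosets -/

section

variable {p : ℕ} [Fact p.Prime] {V : Type*} [AddCommGroup V] [Module (ZMod p) V]

/-- The average of `f` over the coset of `W` through a point. -/
noncomputable def cosetAverage (W : Submodule (ZMod p) V) [Fintype W] (f : V → ℝ) (v : V) : ℝ :=
  (Fintype.card W : ℝ)⁻¹ * ∑ w : W, f (v + w)

variable (W : Submodule (ZMod p) V) [Fintype W]

lemma cosetAverage_add (f : V → ℝ) (v : V) {w : V} (hw : w ∈ W) :
    cosetAverage W f (v + w) = cosetAverage W f v := by
  unfold cosetAverage
  congr 1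
  refine Fintype.sum_equiv (Equiv.addLeft ⟨w, hw⟩) _ _ fun u ↦ ?_
  simp [add_assoc]

lemma cosetAverage_mem_Icc {f : V → ℝ} (hf : ∀ m, f m ∈ Set.Icc (0 : ℝ) 1) (v : V) :
    cosetAverage W f v ∈ Set.Icc (0 : ℝ) 1 := by
  have hcard : (0 : ℝ) < Fintype.card W := by exact_mod_cast Fintype.card_pos
  unfold cosetAverage
  constructor
  · have : 0 ≤ ∑ w : W, f (v + w) := sum_nonneg fun w _ ↦ (hf _).1
    positivity
  · rw [inv_mul_le_iff₀ hcard, mul_one]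
    calc ∑ w : W, f (v + w) ≤ ∑ _w : W, (1 : ℝ) := sum_le_sum fun w _ ↦ (hf _).2
      _ = _ := by simp

end

/-! ### Varnavides' theorem -/

variable {p : ℕ} [Fact p.Prime] {V : Type*} [AddCommGroup V] [Module (ZMod p) V] [Fintype V]

/-- As `d ≠ 0`, the map v ↦ ∑ dᵢ vᵢ is onto V. Hence the pair (first term, common difference) is
equidistributed over V × V, and every progression in V is counted equally often. -/
lemma sum_progressions_linear_combination {k : ℕ} (t : V → ℝ) (x d : Fin k → ZMod p)
    (hd : d ≠ 0) :
    (Fintype.card V : ℝ) * ∑ a : V, ∑ v : Fin k → V,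
        t (a + ∑ i, x i • v i) * t (a + ∑ i, (x + d) i • v i) *
          t (a + ∑ i, (x + 2 • d) i • v i) =
      Fintype.card (Fin k → V) * ∑ m, ∑ e, t m * t (m + e) * t (m + 2 • e) := by
  let φ : (Fin k → V) →+ V :=
    { toFun := fun v ↦ ∑ i, d i • v i
      map_zero' := by simp
      map_add' := fun v w ↦ by simp [sum_add_distrib] }
  have hφ : Function.Surjective φ := by
    obtain ⟨i, hi⟩ := Function.ne_iff.1 hd
    intro u
    refine ⟨Pi.single i ((d i)⁻¹ • u), ?_⟩
    change ∑ j, d j • (Pi.single i ((d i)⁻¹ • u) : Fin k → V) j = u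
    rw [sum_eq_single i]
    · simp only [Pi.single_eq_same]
      exact smul_inv_smul₀ hi u
    · intro j _ hj
      simp [hj]
    · simp
  have key : ∑ a : V, ∑ v : Fin k → V,
        t (a + ∑ i, x i • v i) * t (a + ∑ i, (x + d) i • v i) *
          t (a + ∑ i, (x + 2 • d) i • v i) =
      ∑ v, (fun e ↦ ∑ m, t m * t (m + e) * t (m + 2 • e)) (φ v) := by
    rw [sum_comm]
    refine sum_congr rfl fun v _ ↦ ?_
    refine Fintype.sum_equiv (Equiv.addRight (∑ i, x i • v i)) _ _ fun a ↦ ?_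
    have h1 : a + ∑ i, (x + d) i • v i = a + ∑ i, x i • v i + φ v := by
      simp [φ, add_smul, sum_add_distrib, add_assoc]
    have h2 : a + ∑ i, (x + 2 • d) i • v i = a + ∑ i, x i • v i + 2 • φ v := by
      simp only [φ, two_nsmul, Pi.add_apply, add_smul, sum_add_distrib, add_assoc, AddMonoidHom.coe_mk,
        ZeroHom.coe_mk]
    rw [h1, h2]
    rfl
  rw [key, card_mul_sum_comp_of_surjective φ hφ (fun e ↦ ∑ m, t m * t (m + e) * t (m + 2 • e)),
    sum_comm]

lemma lambda3_nonneg {V : Type*} [AddCommGroup V] [Fintype V] {t : V → ℝ} (ht : ∀ m, 0 ≤ t m) :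
    0 ≤ lambda3 t := by
  unfold lambda3
  have : 0 ≤ ∑ m, ∑ d, t m * t (m + d) * t (m + 2 • d) :=
    sum_nonneg fun m _ ↦ sum_nonneg fun d _ ↦ mul_nonneg (mul_nonneg (ht _) (ht _)) (ht _)
  positivity

lemma sum_eq_sq_mul_lambda3 {V : Type*} [AddCommGroup V] [Fintype V] (t : V → ℝ) :
    ∑ m, ∑ d, t m * t (m + d) * t (m + 2 • d) = (Fintype.card V : ℝ) ^ 2 * lambda3 t := by
  have : (Fintype.card V : ℝ) ≠ 0 := by exact_mod_cast Fintype.card_ne_zero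
  unfold lambda3
  rw [mul_inv_cancel_left₀ (by positivity)]

/-- Varnavides' averaging argument for `k` random directions. -/
lemma pow_three_mul_le_card_sq_mul_lambda3 {k : ℕ} {η : ℝ} (hη : 0 < η)
    (hk : cornersTheoremBound η ≤ Fintype.card (Fin k → ZMod p))
    (t : V → ℝ) (ht : ∀ x, t x ∈ Set.Icc (0 : ℝ) 1) :
    η ^ 3 * (mean t - 2 * η) ≤ (Fintype.card (Fin k → ZMod p) : ℝ) ^ 2 * lambda3 t := by
  set N := (Fintype.card V : ℝ) with hN
  set M := (Fintype.card (Fin k → V) : ℝ) with hM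
  set Q := (Fintype.card (Fin k → ZMod p) : ℝ) with hQ
  have hNpos : 0 < N := by rw [hN]; exact_mod_cast Fintype.card_pos
  have hMpos : 0 < M := by rw [hM]; exact_mod_cast Fintype.card_pos
  have hQpos : 0 < Q := by rw [hQ]; exact_mod_cast Fintype.card_pos
  -- The pullback of `t` along the affine map x ↦ a + ∑ xᵢ vᵢ. Roth's theorem is applied on the
  -- fixed group of coefficient vectors, whose size does not depend on V.
  let s : V → (Fin k → V) → (Fin k → ZMod p) → ℝ := fun a v x ↦ t (a + ∑ i, x i • v i)
  have hsum := sum_le_sum fun (a : V) (_ : a ∈ univ) ↦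
    sum_le_sum fun (v : Fin k → V) (_ : v ∈ univ) ↦
      pow_three_mul_le_sum_nontrivial hη hk (s a v) fun x ↦ ht _
  have hmean : ∑ a : V, ∑ v : Fin k → V, mean (s a v) = N * M * mean t := by
    have h1 : ∀ (v : Fin k → V) (x : Fin k → ZMod p), ∑ a, s a v x = N * mean t := fun v x ↦ by
      unfold mean
      rw [mul_inv_cancel_left₀ hNpos.ne']
      exact Equiv.sum_comp (Equiv.addRight (∑ i, x i • v i)) t
    rw [sum_comm]
    have h2 : ∀ v : Fin k → V, ∑ a, mean (s a v) = N * mean t := fun v ↦ by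
      have : ∑ a, mean (s a v) = Q⁻¹ * ∑ x, ∑ a, s a v x := by
        rw [sum_comm, mul_sum]; rfl
      rw [this]
      simp only [h1, sum_const, card_univ, nsmul_eq_mul]
      rw [← hQ, inv_mul_cancel_left₀ hQpos.ne']
    simp only [h2, sum_const, card_univ, nsmul_eq_mul]
    rw [← hM]; ring
  have hlhs : ∑ a : V, ∑ v : Fin k → V, η ^ 3 * (mean (s a v) - 2 * η) =
      N * M * (η ^ 3 * (mean t - 2 * η)) := by
    simp_rw [mul_sub, sum_sub_distrib, ← mul_sum, hmean, sum_const, card_univ, nsmul_eq_mul]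
    rw [← hN, ← hM]; ring
  have hrhs : ∑ a : V, ∑ v : Fin k → V, ∑ d ∈ univ.filter (· ≠ (0 : Fin k → ZMod p)), ∑ x,
      s a v x * s a v (x + d) * s a v (x + 2 • d) ≤ N * M * (Q ^ 2 * lambda3 t) := by
    have h1 : ∑ a : V, ∑ v : Fin k → V, ∑ d ∈ univ.filter (· ≠ (0 : Fin k → ZMod p)), ∑ x,
        s a v x * s a v (x + d) * s a v (x + 2 • d) =
        ∑ d ∈ univ.filter (· ≠ (0 : Fin k → ZMod p)), ∑ x, ∑ a : V, ∑ v : Fin k → V,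
          s a v x * s a v (x + d) * s a v (x + 2 • d) := by
      calc _ = ∑ a : V, ∑ d ∈ univ.filter (· ≠ (0 : Fin k → ZMod p)), ∑ v : Fin k → V, ∑ x,
            s a v x * s a v (x + d) * s a v (x + 2 • d) :=
            sum_congr rfl fun a _ ↦ sum_comm
        _ = ∑ d ∈ univ.filter (· ≠ (0 : Fin k → ZMod p)), ∑ a : V, ∑ v : Fin k → V, ∑ x,
            s a v x * s a v (x + d) * s a v (x + 2 • d) := sum_comm
        _ = ∑ d ∈ univ.filter (· ≠ (0 : Fin k → ZMod p)), ∑ a : V, ∑ x, ∑ v : Fin k → V,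
            s a v x * s a v (x + d) * s a v (x + 2 • d) :=
            sum_congr rfl fun d _ ↦ sum_congr rfl fun a _ ↦ sum_comm
        _ = _ := sum_congr rfl fun d _ ↦ sum_comm
    have h2 : ∀ d ∈ univ.filter (· ≠ (0 : Fin k → ZMod p)), ∑ x, ∑ a : V, ∑ v : Fin k → V,
        s a v x * s a v (x + d) * s a v (x + 2 • d) = Q * (N * M * lambda3 t) := by
      intro d hd
      have : ∀ x, ∑ a : V, ∑ v : Fin k → V, s a v x * s a v (x + d) * s a v (x + 2 • d) =
          N * M * lambda3 t := fun x ↦ by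
        have := sum_progressions_linear_combination t x d (mem_filter.1 hd).2
        rw [sum_eq_sq_mul_lambda3, ← hN, ← hM] at this
        have h3 : N * ∑ a : V, ∑ v : Fin k → V, s a v x * s a v (x + d) * s a v (x + 2 • d) =
          N * (N * M * lambda3 t) := by
          refine Eq.trans this ?_
          ring
        exact mul_left_cancel₀ hNpos.ne' h3
      rw [sum_congr rfl fun x _ ↦ this x, sum_const, card_univ, nsmul_eq_mul, hQ]
    rw [h1, sum_congr rfl h2, sum_const, nsmul_eq_mul]
    have h4 : ((#(univ.filter (· ≠ (0 : Fin k → ZMod p))) : ℕ) : ℝ) ≤ Q := by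
      rw [hQ]; exact_mod_cast card_le_univ _
    have h5 := lambda3_nonneg fun m ↦ (ht m).1
    calc _ ≤ Q * (Q * (N * M * lambda3 t)) := by gcongr
      _ = _ := by ring
  rw [hlhs] at hsum
  exact le_of_mul_le_mul_left (hsum.trans hrhs) (by positivity)

variable (p) in
/-- Varnavides' theorem in vector spaces over `ZMod p`: functions of positive mean have a positive
proportion of three-term progressions. -/
theorem exists_pos_le_lambda3 {δ : ℝ} (hδ : 0 < δ) :
    ∃ κ : ℝ, 0 < κ ∧ ∀ (V : Type*) [AddCommGroup V] [Module (ZMod p) V] [Fintype V] (t : V → ℝ),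
      (∀ x, t x ∈ Set.Icc (0 : ℝ) 1) → δ ≤ mean t → κ ≤ lambda3 t := by
  -- With this choice mean t - 2η ≥ 2η. Both η and k are independent of V, so κ is uniform.
  set η := δ / 4 with hη
  obtain ⟨k, hk⟩ : ∃ k : ℕ, cornersTheoremBound η ≤ Fintype.card (Fin k → ZMod p) := by
    obtain ⟨k, hk⟩ := pow_unbounded_of_one_lt (cornersTheoremBound η) (Fact.out : p.Prime).one_lt
    exact ⟨k, by simpa [ZMod.card] using hk.le⟩
  have hQ : (0 : ℝ) < Fintype.card (Fin k → ZMod p) := by exact_mod_cast Fintype.card_pos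
  refine ⟨η ^ 3 * (2 * η) / (Fintype.card (Fin k → ZMod p) : ℝ) ^ 2, by positivity, ?_⟩
  intro V _ _ _ t ht hm
  rw [div_le_iff₀' (by positivity)]
  refine le_trans ?_ (pow_three_mul_le_card_sq_mul_lambda3 (by positivity) hk t ht)
  gcongr
  linarith

/-! ### Fourier analysis on V -/

lemma sum_stdAddChar_apply (l : Dual (ZMod p) V) [Decidable (l = 0)] :
    ∑ v, ZMod.stdAddChar (l v) = if l = 0 then (Fintype.card V : ℂ) else 0 := by
  split_ifs with h
  · simp [h]
  · have hne : (ZMod.stdAddChar (N := p)).compAddMonoidHom l.toAddMonoidHom ≠ 1 := by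
      intro h1
      refine h (LinearMap.ext fun v ↦ ?_)
      have := DFunLike.congr_fun h1 v
      exact (ZMod.injective_stdAddChar) (by simpa using this)
    simpa using AddChar.sum_eq_zero_of_ne_one hne

lemma sum_dual_stdAddChar [Fintype (Dual (ZMod p) V)] (v : V) [Decidable (v = 0)] :
    ∑ l : Dual (ZMod p) V, ZMod.stdAddChar (l v) = if v = 0 then (Fintype.card V : ℂ) else 0 := by
  classical
  have h := sum_stdAddChar_apply (Dual.eval (ZMod p) V v)
  have hcard : Fintype.card (Dual (ZMod p) V) = Fintype.card V := by
    rw [Module.card_eq_pow_finrank (K := ZMod p), Subspace.dual_finrank_eq,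
      ← Module.card_eq_pow_finrank (K := ZMod p)]
  simp only [Module.Dual.eval_apply, Module.eval_apply_eq_zero_iff, hcard] at h
  convert h

/-- The Fourier coefficient of `f` at the linear functional `l`. -/
noncomputable def fourier (f : V → ℝ) (l : Dual (ZMod p) V) : ℂ :=
  (Fintype.card V : ℂ)⁻¹ * ∑ v, f v * ZMod.stdAddChar (l v)

lemma card_ne_zero_complex {V : Type*} [AddCommGroup V] [Fintype V] :
    (Fintype.card V : ℂ) ≠ 0 := by
  exact_mod_cast Fintype.card_ne_zero

lemma card_mul_fourier (f : V → ℝ) (l : Dual (ZMod p) V) :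
    (Fintype.card V : ℂ) * fourier f l = ∑ v, f v * ZMod.stdAddChar (l v) :=
  mul_inv_cancel_left₀ card_ne_zero_complex _

lemma fourier_neg (f : V → ℝ) (l : Dual (ZMod p) V) :
    fourier f (-l) = (starRingEnd ℂ) (fourier f l) := by
  simp [fourier, AddChar.map_neg_eq_conj]

section

variable [Fintype (Dual (ZMod p) V)]

lemma sum_fourier_mul_fourier_neg (f : V → ℝ) :
    ∑ l : Dual (ZMod p) V, fourier f l * fourier f (-l) =
      (Fintype.card V : ℂ)⁻¹ * ∑ v, (f v : ℂ) ^ 2 := by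
  classical
  refine mul_left_cancel₀ (pow_ne_zero 2 (card_ne_zero_complex (V := V))) ?_
  calc (Fintype.card V : ℂ) ^ 2 * ∑ l : Dual (ZMod p) V, fourier f l * fourier f (-l)
      = ∑ l : Dual (ZMod p) V, ∑ x, ∑ y, (f x * f y : ℂ) * ZMod.stdAddChar (l (x - y)) := by
        rw [mul_sum]
        refine sum_congr rfl fun l _ ↦ ?_
        rw [sq, mul_mul_mul_comm, card_mul_fourier, card_mul_fourier, sum_mul_sum]
        refine sum_congr rfl fun x _ ↦ sum_congr rfl fun y _ ↦ ?_
        rw [map_sub, sub_eq_add_neg, AddChar.map_add_eq_mul, LinearMap.neg_apply]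
        ring
    _ = ∑ x, ∑ y, (f x * f y : ℂ) * ∑ l : Dual (ZMod p) V, ZMod.stdAddChar (l (x - y)) := by
        rw [sum_comm]
        refine sum_congr rfl fun x _ ↦ ?_
        rw [sum_comm]
        simp_rw [mul_sum]
    _ = ∑ x, ∑ y, if x = y then (f x * f y : ℂ) * Fintype.card V else 0 := by
        simp_rw [sum_dual_stdAddChar, sub_eq_zero, mul_ite, mul_zero]
    _ = (Fintype.card V : ℂ) ^ 2 * ((Fintype.card V : ℂ)⁻¹ * ∑ v, (f v : ℂ) ^ 2) := by
        have : (Fintype.card V : ℂ) ≠ 0 := card_ne_zero_complex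
        simp only [sum_ite_eq, mem_univ, if_true]
        rw [← sum_mul]
        field_simp

/-- Parseval's inequality for functions into `[0, 1]`. -/
lemma sum_norm_fourier_sq_le_one {f : V → ℝ} (hf : ∀ m, f m ∈ Set.Icc (0 : ℝ) 1) :
    ∑ l : Dual (ZMod p) V, ‖fourier f l‖ ^ 2 ≤ 1 := by
  have h1 : ∑ l : Dual (ZMod p) V, ‖fourier f l‖ ^ 2 = (Fintype.card V : ℝ)⁻¹ * ∑ v, f v ^ 2 := by
    have := sum_fourier_mul_fourier_neg (p := p) f
    simp_rw [fourier_neg, Complex.mul_conj'] at this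
    have h2 := congrArg Complex.re this
    rw [← Complex.ofReal_re (∑ l : Dual (ZMod p) V, ‖fourier f l‖ ^ 2),
      ← Complex.ofReal_re ((Fintype.card V : ℝ)⁻¹ * ∑ v, f v ^ 2)]
    push_cast
    exact h2
  have hcard : (0 : ℝ) < Fintype.card V := by exact_mod_cast Fintype.card_pos
  rw [h1, inv_mul_le_iff₀ hcard, mul_one]
  calc ∑ v, f v ^ 2 ≤ ∑ _v : V, (1 : ℝ) :=
        sum_le_sum fun v _ ↦ pow_le_one₀ (hf v).1 (hf v).2
    _ = _ := by simp

/-- Orthogonality over l detects x - 2y + z = 0, which says that x, y, z is a progression. -/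
lemma lambda3_eq_sum_fourier (f : V → ℝ) :
    (lambda3 f : ℂ) = ∑ l : Dual (ZMod p) V, fourier f l ^ 2 * fourier f (-2 • l) := by
  classical
  have hcard : (Fintype.card V : ℂ) ≠ 0 := card_ne_zero_complex
  refine mul_left_cancel₀ (pow_ne_zero 3 hcard) (Eq.symm ?_)
  calc (Fintype.card V : ℂ) ^ 3 * ∑ l : Dual (ZMod p) V, fourier f l ^ 2 * fourier f (-2 • l)
      = ∑ l : Dual (ZMod p) V, ∑ x, ∑ y, ∑ z,
          (f x * f y * f z : ℂ) * ZMod.stdAddChar (l (z - (2 • y - x))) := by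
        rw [mul_sum]
        refine sum_congr rfl fun l _ ↦ ?_
        have : (Fintype.card V : ℂ) ^ 3 * (fourier f l ^ 2 * fourier f (-2 • l)) =
          (Fintype.card V * fourier f l) * ((Fintype.card V * fourier f (-2 • l)) *
            (Fintype.card V * fourier f l)) := by ring
        rw [this, card_mul_fourier, card_mul_fourier, sum_mul_sum, sum_mul_sum]
        refine sum_congr rfl fun x _ ↦ ?_
        refine sum_congr rfl fun y _ ↦ ?_
        rw [mul_sum]
        refine sum_congr rfl fun z _ ↦ ?_
        have : l (z - (2 • y - x)) = l x + ((-2 • l) y + l z) := by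
          simp only [map_sub, map_nsmul, LinearMap.smul_apply, neg_smul, LinearMap.neg_apply]
          simp only [two_nsmul, two_zsmul]
          ring
        rw [this, AddChar.map_add_eq_mul, AddChar.map_add_eq_mul]
        ring
    _ = ∑ x, ∑ y, ∑ z, (f x * f y * f z : ℂ) *
          ∑ l : Dual (ZMod p) V, ZMod.stdAddChar (l (z - (2 • y - x))) := by
        rw [sum_comm]
        refine sum_congr rfl fun x _ ↦ ?_
        rw [sum_comm]
        refine sum_congr rfl fun y _ ↦ ?_
        rw [sum_comm]
        simp_rw [mul_sum]
    _ = ∑ x, ∑ y, (f x * f y * f (2 • y - x) : ℂ) * Fintype.card V := by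
        simp_rw [sum_dual_stdAddChar, sub_eq_zero, mul_ite, mul_zero, sum_ite_eq', mem_univ, if_true]
    _ = ∑ m, ∑ d, (f m * f (m + d) * f (m + 2 • d) : ℂ) * Fintype.card V := by
        refine sum_congr rfl fun m _ ↦ ?_
        refine (Fintype.sum_equiv (Equiv.addLeft m) _ _ fun d ↦ ?_).symm
        have : 2 • (m + d) - m = m + 2 • d := by rw [smul_add, two_nsmul m]; abel
        rw [Equiv.coe_addLeft, this]
    _ = (Fintype.card V : ℂ) ^ 3 * (lambda3 f : ℂ) := by
        simp_rw [← sum_mul]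
        unfold lambda3
        push_cast
        field_simp

end

/-! ### Coset averages on the Fourier side -/

section

variable (W : Submodule (ZMod p) V) [Fintype W]

/-- Averaging over cosets is self-adjoint against functions constant on cosets. -/
lemma sum_mul_cosetAverage (f k : V → ℝ) (hk : ∀ v, ∀ w ∈ W, k (v + w) = k v) :
    ∑ v, k v * cosetAverage W f v = ∑ v, k v * f v := by
  have hcard : (Fintype.card W : ℝ) ≠ 0 := by exact_mod_cast Fintype.card_ne_zero
  refine mul_left_cancel₀ hcard ?_
  calc (Fintype.card W : ℝ) * ∑ v, k v * cosetAverage W f v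
      = ∑ v, ∑ w : W, k (v + w) * f (v + w) := by
        rw [mul_sum]
        refine sum_congr rfl fun v _ ↦ ?_
        unfold cosetAverage
        rw [mul_left_comm, mul_inv_cancel_left₀ hcard, mul_sum]
        exact sum_congr rfl fun w _ ↦ by rw [hk v w w.2]
    _ = ∑ w : W, ∑ v, k v * f v := by
        rw [sum_comm]
        exact sum_congr rfl fun w _ ↦
          Equiv.sum_comp (Equiv.addRight (w : V)) (fun v ↦ k v * f v)
    _ = _ := by simp

lemma mean_cosetAverage (f : V → ℝ) : mean (cosetAverage W f) = mean f := by
  unfold mean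
  simpa using congrArg ((Fintype.card V : ℝ)⁻¹ * ·)
    (sum_mul_cosetAverage W f (fun _ ↦ 1) fun _ _ _ ↦ rfl)

/-- Averaging is convolution with the uniform measure on W, and the sum of a character over W
vanishes unless the character is trivial there. -/
lemma fourier_cosetAverage (f : V → ℝ) (l : Dual (ZMod p) V) [Decidable (l ∈ W.dualAnnihilator)] :
    fourier (cosetAverage W f) l = if l ∈ W.dualAnnihilator then fourier f l else 0 := by
  classical
  have hcard : (Fintype.card W : ℂ) ≠ 0 := card_ne_zero_complex
  refine mul_left_cancel₀ (mul_ne_zero hcard (card_ne_zero_complex (V := V))) ?_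
  rw [mul_assoc, card_mul_fourier]
  have hl : l.comp W.subtype = 0 ↔ l ∈ W.dualAnnihilator := by
    rw [Submodule.mem_dualAnnihilator, LinearMap.ext_iff]
    simp
  calc (Fintype.card W : ℂ) * ∑ v, cosetAverage W f v * ZMod.stdAddChar (l v)
      = ∑ v, ∑ w : W, f (v + w) * ZMod.stdAddChar (l (v + w)) * ZMod.stdAddChar (-l w) := by
        rw [mul_sum]
        refine sum_congr rfl fun v _ ↦ ?_
        unfold cosetAverage
        push_cast
        rw [← mul_assoc, mul_inv_cancel_left₀ hcard, sum_mul]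
        refine sum_congr rfl fun w _ ↦ ?_
        rw [mul_assoc, ← AddChar.map_add_eq_mul, map_add l, add_neg_cancel_right]
    _ = ∑ w : W, (∑ v, f v * ZMod.stdAddChar (l v)) * ZMod.stdAddChar ((-l.comp W.subtype) w) := by
        rw [sum_comm]
        refine sum_congr rfl fun w _ ↦ ?_
        rw [← sum_mul]
        congr 1
        exact Equiv.sum_comp (Equiv.addRight (w : V))
          (fun v ↦ (f v : ℂ) * ZMod.stdAddChar (l v))
    _ = _ := by
        rw [← mul_sum, sum_stdAddChar_apply]
        simp only [neg_eq_zero, hl]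
        split_ifs
        · rw [← card_mul_fourier]; ring
        · simp

end

/-- If the large Fourier coefficients of `f` vanish on `W`, averaging over cosets of `W` hardly
increases the number of progressions. -/
lemma lambda3_cosetAverage_le (hp : p ≠ 2) {f : V → ℝ} (hf : ∀ m, f m ∈ Set.Icc (0 : ℝ) 1)
    (W : Submodule (ZMod p) V) [Fintype W] {ε : ℝ} (hε : 0 ≤ ε)
    (hW : ∀ l ∉ W.dualAnnihilator, ‖fourier f l‖ ≤ ε) :
    lambda3 (cosetAverage W f) ≤ lambda3 f + ε := by
  classical
  have : Finite (Dual (ZMod p) V) := DFunLike.finite _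
  have := Fintype.ofFinite (Dual (ZMod p) V)
  have h2 : (-2 : ZMod p) ≠ 0 := by
    rw [Ne, neg_eq_zero]
    exact Ring.two_ne_zero (by rwa [ZMod.ringChar_zmod_n])
  -- As p is odd, -2 is invertible. So each discarded term f̂(l)² f̂(-2l) has -2l outside the
  -- annihilator and its last factor is at most ε; Parseval sums the squares.
  have hmem : ∀ l : Dual (ZMod p) V, -2 • l ∈ W.dualAnnihilator ↔ l ∈ W.dualAnnihilator := by
    intro l
    have : -2 • l = (-2 : ZMod p) • l := by
      refine LinearMap.ext fun v ↦ ?_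
      rw [LinearMap.smul_apply, LinearMap.smul_apply, zsmul_eq_mul, smul_eq_mul]
      push_cast
      rfl
    rw [this, Submodule.smul_mem_iff _ h2]
  have hdiff : ((lambda3 (cosetAverage W f) - lambda3 f : ℝ) : ℂ) =
      ∑ l : Dual (ZMod p) V, if l ∈ W.dualAnnihilator then 0
        else -(fourier f l ^ 2 * fourier f (-2 • l)) := by
    push_cast
    rw [lambda3_eq_sum_fourier (p := p), lambda3_eq_sum_fourier (p := p), ← sum_sub_distrib]
    refine sum_congr rfl fun l _ ↦ ?_
    rw [fourier_cosetAverage, fourier_cosetAverage]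
    simp only [hmem]
    split_ifs <;> simp
  have hnorm : ‖((lambda3 (cosetAverage W f) - lambda3 f : ℝ) : ℂ)‖ ≤ ε := by
    rw [hdiff]
    calc _ ≤ ∑ l : Dual (ZMod p) V, ‖fourier f l‖ ^ 2 * ε := by
          refine norm_sum_le_of_le _ fun l _ ↦ ?_
          split_ifs with h
          · rw [norm_zero]; positivity
          · rw [norm_neg, norm_mul, norm_pow]
            gcongr
            exact hW _ (by rwa [hmem])
      _ ≤ 1 * ε := by
          rw [← sum_mul]
          gcongr
          exact sum_norm_fourier_sq_le_one hf
      _ = ε := one_mul ε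
  rw [Complex.norm_real, Real.norm_eq_abs] at hnorm
  linarith [le_abs_self (lambda3 (cosetAverage W f) - lambda3 f)]

/-- The large Fourier coefficients of `f` all vanish on a subspace of bounded codimension. -/
lemma exists_subspace_fourier_le {f : V → ℝ} (hf : ∀ m, f m ∈ Set.Icc (0 : ℝ) 1)
    {ε : ℝ} (hε : 0 < ε) :
    ∃ W : Submodule (ZMod p) V,
      Module.finrank (ZMod p) V ≤ Module.finrank (ZMod p) W + ⌊(ε ^ 2)⁻¹⌋₊ ∧
      ∀ l ∉ W.dualAnnihilator, ‖fourier f l‖ ≤ ε := by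
  classical
  have : Finite (Dual (ZMod p) V) := DFunLike.finite _
  have := Fintype.ofFinite (Dual (ZMod p) V)
  let S : Finset (Dual (ZMod p) V) := univ.filter fun l ↦ ε ≤ ‖fourier f l‖
  have hS : #S ≤ ⌊(ε ^ 2)⁻¹⌋₊ := by
    refine Nat.le_floor ?_
    rw [← one_div, le_div_iff₀ (by positivity)]
    calc (#S : ℝ) * ε ^ 2 = ∑ _l ∈ S, ε ^ 2 := by simp
      _ ≤ ∑ l ∈ S, ‖fourier f l‖ ^ 2 := by
          refine sum_le_sum fun l hl ↦ ?_
          have := (mem_filter.1 hl).2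
          gcongr
      _ ≤ ∑ l : Dual (ZMod p) V, ‖fourier f l‖ ^ 2 :=
          sum_le_sum_of_subset_of_nonneg (subset_univ _) fun _ _ _ ↦ by positivity
      _ ≤ 1 := sum_norm_fourier_sq_le_one hf
  -- W is the common kernel of the functionals in `S`; its codimension is the dimension of their
  -- span.
  refine ⟨(Submodule.span (ZMod p) (S : Set (Dual (ZMod p) V))).dualCoannihilator, ?_, ?_⟩
  · rw [← Subspace.finrank_add_finrank_dualCoannihilator_eq
      (Submodule.span (ZMod p) (S : Set (Dual (ZMod p) V))), add_comm]
    gcongr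
    exact (finrank_span_finset_le_card S).trans hS
  · intro l hl
    by_contra! h
    refine hl (Submodule.le_dualCoannihilator_dualAnnihilator _ (Submodule.subset_span ?_))
    simpa [S] using h.le

/-! ### The perturbation that lowers Λ₃ -/

variable (p) in
/-- The mean-zero function `1 / p - 1_{0}` on `ZMod p`, whose progression count is negative. -/
noncomputable def balancedPoint (x : ZMod p) : ℝ := (p : ℝ)⁻¹ - if x = 0 then 1 else 0

lemma sum_balancedPoint_add (a : ZMod p) : ∑ i, balancedPoint p (a + i) = 0 := by
  have hp0 : (p : ℝ) ≠ 0 := by exact_mod_cast (Fact.out : p.Prime).ne_zero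
  rw [show ∑ i, balancedPoint p (a + i) = ∑ i, balancedPoint p i from
    Equiv.sum_comp (Equiv.addLeft a) (balancedPoint p)]
  simp [balancedPoint, ZMod.card, hp0]

lemma abs_balancedPoint_le (x : ZMod p) : |balancedPoint p x| ≤ 1 := by
  have h1 : (p : ℝ)⁻¹ ≤ 1 :=
    inv_le_one_of_one_le₀ (by exact_mod_cast (Fact.out : p.Prime).one_lt.le)
  have h0 : 0 ≤ (p : ℝ)⁻¹ := by positivity
  unfold balancedPoint
  rw [abs_le]
  split_ifs <;> constructor <;> linarith

/-- For odd p any two of i, i + j, i + 2j are independent and uniform, so terms with one or two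
mean-zero factors cancel. The triple term is negative because all three forms vanish together with
probability p⁻², not p⁻³. -/
lemma sum_progression_balancedPoint (hp : p ≠ 2) (A₀ A₁ A₂ T₀ T₁ T₂ : ℝ) :
    ∑ i : ZMod p, ∑ j : ZMod p, (A₀ + T₀ * balancedPoint p i) *
        (A₁ + T₁ * balancedPoint p (i + j)) * (A₂ + T₂ * balancedPoint p (i + 2 * j)) =
      (p : ℝ) ^ 2 * (A₀ * A₁ * A₂) - (1 - (p : ℝ)⁻¹) * (T₀ * T₁ * T₂) := by
  have hp0 : (p : ℝ) ≠ 0 := by exact_mod_cast (Fact.out : p.Prime).ne_zero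
  have h2 : (2 : ZMod p) ≠ 0 := Ring.two_ne_zero (by rwa [ZMod.ringChar_zmod_n])
  let e : ZMod p → ℝ := fun x ↦ if x = 0 then 1 else 0
  have e_sum : ∑ x, e x = 1 := by simp [e]
  have e_left : ∀ a, ∑ x, e (a + x) = 1 := fun a ↦
    (Equiv.sum_comp (Equiv.addLeft a) e).trans e_sum
  have e_right : ∀ a, ∑ x, e (x + a) = 1 := fun a ↦
    (Equiv.sum_comp (Equiv.addRight a) e).trans e_sum
  have e_two : ∀ a, ∑ x, e (a + 2 * x) = 1 := fun a ↦
    (Equiv.sum_comp (Equiv.mulLeft₀ (2 : ZMod p) h2) fun x ↦ e (a + x)).trans (e_left a)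
  have e_mul : ∀ (x : ZMod p) (F : ZMod p → ℝ), e x * F x = e x * F 0 := fun x F ↦ by
    by_cases hx : x = 0 <;> simp [e, hx]
  have s12 : ∑ i : ZMod p, ∑ j : ZMod p, e (i + j) * e (i + 2 * j) = 1 := by
    rw [sum_comm]
    have : ∀ j : ZMod p, ∑ i, e (i + j) * e (i + 2 * j) = e j := fun j ↦ by
      calc ∑ i, e (i + j) * e (i + 2 * j) = ∑ i, e (i + j) * e (0 + j) := by
            refine sum_congr rfl fun i _ ↦ ?_
            rw [← e_mul (i + j) fun x ↦ e (x + j)]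
            congr 2; ring
        _ = e j := by rw [← sum_mul, e_right, one_mul, zero_add]
    simp_rw [this, e_sum]
  have s012 : ∑ i : ZMod p, ∑ j : ZMod p, e i * e (i + j) * e (i + 2 * j) = 1 := by
    have : ∀ i : ZMod p, ∑ j, e i * e (i + j) * e (i + 2 * j) = e i := fun i ↦ by
      calc ∑ j, e i * e (i + j) * e (i + 2 * j) = ∑ j, e i * (e (0 + j) * e (0 + 2 * j)) := by
            refine sum_congr rfl fun j _ ↦ ?_
            rw [mul_assoc, e_mul i fun x ↦ e (x + j) * e (x + 2 * j)]
        _ = e i * ∑ j, e j * e (2 * 0) := by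
            rw [mul_sum]
            refine sum_congr rfl fun j _ ↦ ?_
            rw [zero_add, zero_add, e_mul j fun x ↦ e (2 * x)]
        _ = e i := by rw [← sum_mul, e_sum]; simp [e]
    simp_rw [this, e_sum]
  have expand : ∀ i j : ZMod p, (A₀ + T₀ * balancedPoint p i) *
        (A₁ + T₁ * balancedPoint p (i + j)) * (A₂ + T₂ * balancedPoint p (i + 2 * j)) =
      (A₀ + T₀ * (p : ℝ)⁻¹) * (A₁ + T₁ * (p : ℝ)⁻¹) * (A₂ + T₂ * (p : ℝ)⁻¹)
      - T₀ * (A₁ + T₁ * (p : ℝ)⁻¹) * (A₂ + T₂ * (p : ℝ)⁻¹) * e i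
      - (A₀ + T₀ * (p : ℝ)⁻¹) * T₁ * (A₂ + T₂ * (p : ℝ)⁻¹) * e (i + j)
      - (A₀ + T₀ * (p : ℝ)⁻¹) * (A₁ + T₁ * (p : ℝ)⁻¹) * T₂ * e (i + 2 * j)
      + T₀ * T₁ * (A₂ + T₂ * (p : ℝ)⁻¹) * (e i * e (i + j))
      + T₀ * (A₁ + T₁ * (p : ℝ)⁻¹) * T₂ * (e i * e (i + 2 * j))
      + (A₀ + T₀ * (p : ℝ)⁻¹) * T₁ * T₂ * (e (i + j) * e (i + 2 * j))
      - T₀ * T₁ * T₂ * (e i * e (i + j) * e (i + 2 * j)) := fun i j ↦ by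
    simp only [balancedPoint, e]; ring
  simp only [expand, sum_add_distrib, sum_sub_distrib]
  simp only [← mul_sum, e_sum, e_left, e_two, s12, s012, mul_one, sum_const, card_univ, ZMod.card,
    nsmul_eq_mul]
  field_simp
  ring

/-- Perturbing along a functional `l`: if `t` is invariant in a direction on which `l` does not
vanish, then the mean is preserved. -/
lemma mean_add_mul_balancedPoint (l : Dual (ZMod p) V) (e : V) (he : l e = 1) (F t : V → ℝ)
    (ht : ∀ v, ∀ i : ZMod p, t (v + i • e) = t v) :
    mean (fun v ↦ F v + t v * balancedPoint p (l v)) = mean F := by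
  have hp0 : (p : ℝ) ≠ 0 := by exact_mod_cast (Fact.out : p.Prime).ne_zero
  have key : (p : ℝ) * ∑ v, t v * balancedPoint p (l v) = 0 := by
    calc (p : ℝ) * ∑ v, t v * balancedPoint p (l v)
        = ∑ i : ZMod p, ∑ v, t v * balancedPoint p (l v) := by simp [ZMod.card]
      _ = ∑ i : ZMod p, ∑ v, t (v + i • e) * balancedPoint p (l (v + i • e)) :=
          sum_congr rfl fun i _ ↦ (Equiv.sum_comp (Equiv.addRight (i • e))
            fun v ↦ t v * balancedPoint p (l v)).symm
      _ = ∑ v, t v * ∑ i : ZMod p, balancedPoint p (l v + i) := by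
          rw [sum_comm]
          simp_rw [mul_sum, ht, map_add, map_smul, he, smul_eq_mul, mul_one]
      _ = 0 := by simp [sum_balancedPoint_add]
  unfold mean
  rw [sum_add_distrib, (mul_eq_zero.1 key).resolve_left hp0, add_zero]

/-- Shifting m and d by multiples of `e` leaves `F` and `t` fixed and moves the values of `l` over
all pairs in ZMod p, so the identity on ZMod p applies fibrewise. -/
lemma lambda3_add_mul_balancedPoint (hp : p ≠ 2) (l : Dual (ZMod p) V) (e : V) (he : l e = 1)
    (F t : V → ℝ) (hF : ∀ v, ∀ i : ZMod p, F (v + i • e) = F v)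
    (ht : ∀ v, ∀ i : ZMod p, t (v + i • e) = t v) :
    lambda3 (fun v ↦ F v + t v * balancedPoint p (l v)) =
      lambda3 F - ((p : ℝ) ^ 2)⁻¹ * (1 - (p : ℝ)⁻¹) * lambda3 t := by
  have hp0 : (p : ℝ) ≠ 0 := by exact_mod_cast (Fact.out : p.Prime).ne_zero
  have hV : (Fintype.card V : ℝ) ≠ 0 := by exact_mod_cast Fintype.card_ne_zero
  set g : V → ℝ := fun v ↦ F v + t v * balancedPoint p (l v) with hg
  have hshift : ∀ (m d : V) (i j : ZMod p),
      g (m + i • e) * g (m + i • e + (d + j • e)) * g (m + i • e + 2 • (d + j • e)) =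
        (F m + t m * balancedPoint p (l m + i)) *
        (F (m + d) + t (m + d) * balancedPoint p (l m + i + (l d + j))) *
        (F (m + 2 • d) + t (m + 2 • d) * balancedPoint p (l m + i + 2 * (l d + j))) := by
    intro m d i j
    have h1 : m + i • e + (d + j • e) = m + d + (i + j) • e := by rw [add_smul]; abel
    have h2 : m + i • e + 2 • (d + j • e) = m + 2 • d + (i + 2 * j) • e := by
      rw [add_smul, two_mul, add_smul, two_nsmul, two_nsmul]; abel
    rw [h1, h2]
    simp only [hg, hF, ht, map_add, map_smul, he, smul_eq_mul, mul_one, map_nsmul, nsmul_eq_mul]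
    push_cast
    congr 4 <;> ring_nf
  have key : (p : ℝ) ^ 2 * ∑ m, ∑ d, g m * g (m + d) * g (m + 2 • d) =
      ∑ m, ∑ d, ((p : ℝ) ^ 2 * (F m * F (m + d) * F (m + 2 • d)) -
        (1 - (p : ℝ)⁻¹) * (t m * t (m + d) * t (m + 2 • d))) := by
    calc (p : ℝ) ^ 2 * ∑ m, ∑ d, g m * g (m + d) * g (m + 2 • d)
        = ∑ i : ZMod p, ∑ j : ZMod p, ∑ m, ∑ d, g m * g (m + d) * g (m + 2 • d) := by
          simp only [sum_const, card_univ, ZMod.card, nsmul_eq_mul]; ring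
      _ = ∑ i : ZMod p, ∑ j : ZMod p, ∑ m, ∑ d,
            g (m + i • e) * g (m + i • e + (d + j • e)) * g (m + i • e + 2 • (d + j • e)) := by
          refine sum_congr rfl fun i _ ↦ sum_congr rfl fun j _ ↦ ?_
          rw [← Equiv.sum_comp (Equiv.addRight (i • e))]
          refine sum_congr rfl fun m _ ↦ ?_
          rw [← Equiv.sum_comp (Equiv.addRight (j • e))]
          rfl
      _ = ∑ m, ∑ d, ∑ i : ZMod p, ∑ j : ZMod p,
            g (m + i • e) * g (m + i • e + (d + j • e)) * g (m + i • e + 2 • (d + j • e)) := by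
          simp_rw [sum_comm (s := (univ : Finset (ZMod p))) (t := (univ : Finset V))]
      _ = _ := by
          refine sum_congr rfl fun m _ ↦ sum_congr rfl fun d _ ↦ ?_
          simp_rw [hshift]
          rw [← sum_progression_balancedPoint hp]
          refine Fintype.sum_equiv (Equiv.addLeft (l m)) _ _ fun i ↦ ?_
          exact Fintype.sum_equiv (Equiv.addLeft (l d)) _ _ fun j ↦ rfl
  simp_rw [sum_sub_distrib, ← mul_sum, sum_eq_sq_mul_lambda3] at key
  have : (p : ℝ) ^ 2 * (Fintype.card V : ℝ) ^ 2 ≠ 0 := by positivity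
  refine mul_left_cancel₀ this ?_
  rw [mul_assoc, key]
  field_simp

/-! ### Structure of minimisers -/

/-- If averaging a minimiser `f` over the cosets of `W` hardly increases `Λ₃`, then the coset
averages are mostly close to `0` or `1`: otherwise a perturbation would beat `f`. -/
lemma mean_min_cosetAverage_lt (hp : p ≠ 2) {α δ κ : ℝ}
    (hκ : ∀ t : V → ℝ, (∀ x, t x ∈ Set.Icc (0 : ℝ) 1) → δ ≤ mean t → κ ≤ lambda3 t)
    {f : V → ℝ} (hf : IsMinimiser α f) (W : Submodule (ZMod p) V) [Fintype W] (hW : W ≠ ⊥)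
    (hlt : lambda3 (cosetAverage W f) <
      lambda3 f + ((p : ℝ) ^ 2)⁻¹ * (1 - (p : ℝ)⁻¹) * κ) :
    mean (fun v ↦ min (cosetAverage W f v) (1 - cosetAverage W f v)) < δ := by
  by_contra! hδ
  set F := cosetAverage W f with hFdef
  set t : V → ℝ := fun v ↦ min (F v) (1 - F v) with htdef
  have hF01 : ∀ v, F v ∈ Set.Icc (0 : ℝ) 1 := cosetAverage_mem_Icc W hf.1.1
  have ht0 : ∀ v, 0 ≤ t v := fun v ↦ le_min (hF01 v).1 (by linarith [(hF01 v).2])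
  have ht01 : ∀ v, t v ∈ Set.Icc (0 : ℝ) 1 := fun v ↦
    ⟨ht0 v, (min_le_left _ _).trans (hF01 v).2⟩
  obtain ⟨u, hu, hu0⟩ := (Submodule.ne_bot_iff W).1 hW
  obtain ⟨l, hl⟩ : ∃ l : Dual (ZMod p) V, l u = 1 := by
    obtain ⟨l, hl⟩ := not_forall.1 (mt (Module.forall_dual_apply_eq_zero_iff (ZMod p) u).1 hu0)
    exact ⟨(l u)⁻¹ • l, by simp [inv_mul_cancel₀ hl]⟩
  have hF : ∀ v, ∀ i : ZMod p, F (v + i • u) = F v := fun v i ↦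
    cosetAverage_add W f v (W.smul_mem i hu)
  have ht : ∀ v, ∀ i : ZMod p, t (v + i • u) = t v := fun v i ↦ by simp only [htdef, hF]
  -- The amplitude `t` is the largest for which a factor in [-1, 1] is certain to keep the values in
  -- [0, 1].
  set g : V → ℝ := fun v ↦ F v + t v * balancedPoint p (l v) with hg
  have hgadm : Admissible α g := by
    refine ⟨fun v ↦ ?_, ?_⟩
    · have h1 : |t v * balancedPoint p (l v)| ≤ t v := by
        rw [abs_mul, abs_of_nonneg (ht0 v)]
        exact mul_le_of_le_one_right (ht0 v) (abs_balancedPoint_le _)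
      have h2 := abs_le.1 h1
      have h3 : t v ≤ F v := min_le_left _ _
      have h4 : t v ≤ 1 - F v := min_le_right _ _
      constructor <;> simp only [hg] <;> linarith
    · rw [hg, mean_add_mul_balancedPoint l u hl F t ht, hFdef, mean_cosetAverage]
      exact hf.1.2
  have h1 := hf.2 g hgadm
  rw [hg, lambda3_add_mul_balancedPoint hp l u hl F t hF ht] at h1
  have hc : 0 ≤ ((p : ℝ) ^ 2)⁻¹ * (1 - (p : ℝ)⁻¹) := by
    have : (p : ℝ)⁻¹ ≤ 1 :=
      inv_le_one_of_one_le₀ (by exact_mod_cast (Fact.out : p.Prime).one_lt.le)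
    exact mul_nonneg (by positivity) (by linarith)
  have h2 := mul_le_mul_of_nonneg_left (hκ t ht01 hδ) hc
  linarith

/-- Rounding the coset averages. -/
lemma exists_indicator_mean_abs_sub_le {f : V → ℝ} (hf : ∀ m, f m ∈ Set.Icc (0 : ℝ) 1)
    (W : Submodule (ZMod p) V) [Fintype W] :
    ∃ h : V → ℝ, (∀ a, h a = 0 ∨ h a = 1) ∧ (∀ a, ∀ w ∈ W, h (a + w) = h a) ∧
      mean (fun m ↦ |f m - h m|) =
        mean (fun v ↦ min (cosetAverage W f v) (1 - cosetAverage W f v)) := by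
  classical
  set F := cosetAverage W f with hF
  let h : V → ℝ := fun v ↦ if F v ≤ 1 / 2 then 0 else 1
  have hinv : ∀ a, ∀ w ∈ W, h (a + w) = h a := fun a w hw ↦ by
    simp only [h, hF, cosetAverage_add W f a hw]
  refine ⟨h, fun a ↦ ?_, hinv, ?_⟩
  · simp only [h]; split_ifs <;> simp
  -- With `h` the rounding of `F`, both |f - h| and min(F, 1 - F) come from x ↦ h + (1 - 2h) x, at x
  -- = f and x = F. The coefficients are constant on cosets, so the means agree.
  · have h1 : ∀ v, |f v - h v| = h v + (1 - 2 * h v) * f v := fun v ↦ by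
      have := hf v
      simp only [h]
      split_ifs
      · rw [sub_zero, abs_of_nonneg this.1]; ring
      · rw [abs_of_nonpos (by linarith [this.2])]; ring
    have h2 : ∀ v, min (F v) (1 - F v) = h v + (1 - 2 * h v) * F v := fun v ↦ by
      simp only [h]
      split_ifs
      · rw [min_eq_left (by linarith)]; ring
      · rw [min_eq_right (by linarith)]; ring
    unfold mean
    simp_rw [h1, h2, sum_add_distrib]
    rw [hF, sum_mul_cosetAverage W f (fun v ↦ 1 - 2 * h v) fun v w hw ↦ by rw [hinv v w hw]]

variable (p) in
/-- For a fixed error `δ`, minimisers are `δ`-close to unions of cosets of a subspace of bounded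
codimension, as soon as the dimension exceeds the bound. -/
lemma exists_codim_bound (hp : p ≠ 2) (α : ℝ) {δ : ℝ} (hδ : 0 < δ) :
    ∃ K : ℕ, ∀ (V : Type*) [AddCommGroup V] [Module (ZMod p) V] [Fintype V],
      K < Module.finrank (ZMod p) V → ∀ f : V → ℝ, IsMinimiser α f →
        ∃ W : Submodule (ZMod p) V,
          Module.finrank (ZMod p) V ≤ Module.finrank (ZMod p) W + K ∧
          ∃ h : V → ℝ, (∀ a, h a = 0 ∨ h a = 1) ∧ (∀ a, ∀ w ∈ W, h (a + w) = h a) ∧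
            mean (fun m ↦ |f m - h m|) ≤ δ := by
  classical
  obtain ⟨κ, hκ0, hκ⟩ := exists_pos_le_lambda3 p hδ
  have hp1 : (p : ℝ)⁻¹ < 1 :=
    inv_lt_one_of_one_lt₀ (by exact_mod_cast (Fact.out : p.Prime).one_lt)
  have hp0 : (0 : ℝ) < p := by exact_mod_cast (Fact.out : p.Prime).pos
  set c := ((p : ℝ) ^ 2)⁻¹ * (1 - (p : ℝ)⁻¹) * κ with hc
  have hc0 : 0 < c := mul_pos (mul_pos (by positivity) (by linarith)) hκ0
  -- Here `c` is the guaranteed drop in Λ₃. The Fourier threshold c/2 makes the loss from averaging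
  -- strictly smaller, and dimension above this bound forces W ≠ ⊥.
  refine ⟨⌊((c / 2) ^ 2)⁻¹⌋₊, fun V _ _ _ hV f hf ↦ ?_⟩
  obtain ⟨W, hW1, hW2⟩ := exists_subspace_fourier_le (p := p) hf.1.1 (half_pos hc0)
  have hWbot : W ≠ ⊥ := by
    rintro rfl
    rw [finrank_bot] at hW1
    omega
  obtain ⟨h, h1, h2, h3⟩ := exists_indicator_mean_abs_sub_le hf.1.1 W
  refine ⟨W, hW1, h, h1, h2, h3.trans_le (mean_min_cosetAverage_lt hp (hκ V) hf W hWbot ?_).le⟩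
  have := lambda3_cosetAverage_le hp hf.1.1 W (half_pos hc0).le hW2
  linarith

/-! ### Letting the precision depend on n -/

/-- Bounds `K j` for every precision `j` can be traded for a sublinear bound along `j → ∞`. -/
lemma exists_slowly_growing (K : ℕ → ℕ) :
    ∃ j : ℕ → ℕ, Filter.Tendsto j Filter.atTop Filter.atTop ∧
      ∀ n, 0 < j n → j n * K (j n) < n := by
  classical
  -- The default value 0 of `Nat.findGreatest` marks those n for which no positive j ≤ n qualifies.
  refine ⟨fun n ↦ Nat.findGreatest (fun j ↦ j * K j < n) n, ?_, fun n hn ↦ ?_⟩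
  · refine Filter.tendsto_atTop.2 fun J ↦ ?_
    filter_upwards [Filter.eventually_ge_atTop (J * K J + 1 + J)] with n hn
    exact Nat.le_findGreatest (by omega) (by omega)
  · exact Nat.findGreatest_of_ne_zero (P := fun j ↦ j * K j < n) rfl hn.ne'

lemma mean_le_one {V : Type*} [AddCommGroup V] [Fintype V] {f : V → ℝ} (hf : ∀ m, f m ≤ 1) :
    mean f ≤ 1 := by
  have hcard : (0 : ℝ) < Fintype.card V := by exact_mod_cast Fintype.card_pos
  unfold mean
  rw [inv_mul_le_iff₀ hcard]
  calc ∑ m, f m ≤ ∑ _m : V, (1 : ℝ) := sum_le_sum fun m _ ↦ hf m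
    _ = _ := by simp

end ThreeAP

theorem theorem2 (p : ℕ) [Fact p.Prime] (hp : p ≠ 2) (α : ℝ) (hα0 : 0 < α) (hα1 : α ≤ 1) :
    ∃ c δ : ℕ → ℝ,
      Asymptotics.IsLittleO Filter.atTop c (fun n : ℕ => (n : ℝ)) ∧
      Filter.Tendsto δ Filter.atTop (nhds 0) ∧
      ∀ (n : ℕ) (V : Type*) [AddCommGroup V] [Module (ZMod p) V] [Fintype V],
        Module.finrank (ZMod p) V = n →
        ∀ f : V → ℝ, ThreeAP.IsMinimiser α f →
          ∃ W : Submodule (ZMod p) V,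
            (n : ℝ) - c n ≤ (Module.finrank (ZMod p) W : ℝ) ∧
            ∃ h : V → ℝ,
              (∀ a, h a = 0 ∨ h a = 1) ∧
              (∀ a, ∀ w ∈ W, h (a + w) = h a) ∧
              ThreeAP.mean (fun m => |f m - h m|) ≤ δ n := by
  have hpos : ∀ j : ℕ, (0 : ℝ) < ((j : ℝ) + 1)⁻¹ := fun j ↦ by positivity
  choose K hK using fun j : ℕ ↦ ThreeAP.exists_codim_bound p hp α (hpos j)
  obtain ⟨j, hj, hjK⟩ := ThreeAP.exists_slowly_growing K
  -- When j n > 0, K (j n) < n / j n, which is o(n). The finitely many n with j n = 0 are covered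
  -- trivially by W = ⊥ and h = 0.
  refine ⟨fun n ↦ if 0 < j n then K (j n) else n, fun n ↦ if 0 < j n then ((j n : ℝ) + 1)⁻¹ else 1,
    ?_, ?_, ?_⟩
  · rw [Asymptotics.isLittleO_iff]
    intro ε hε
    filter_upwards [hj.eventually_gt_atTop 0, hj.eventually_ge_atTop ⌈ε⁻¹⌉₊] with n hn0 hn
    rw [if_pos hn0, Real.norm_natCast, Real.norm_natCast]
    have h1 : ε⁻¹ ≤ j n := (Nat.le_ceil _).trans (by exact_mod_cast hn)
    have h2 : (j n : ℝ) * K (j n) ≤ n := by exact_mod_cast (hjK n hn0).le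
    have h3 : ε⁻¹ * K (j n) ≤ n := (by gcongr : ε⁻¹ * K (j n) ≤ j n * K (j n)).trans h2
    rwa [inv_mul_le_iff₀ hε] at h3
  · have h0 : Filter.Tendsto (fun n ↦ ((j n : ℝ) + 1)⁻¹) Filter.atTop (nhds 0) := by
      have := tendsto_one_div_add_atTop_nhds_zero_nat (𝕜 := ℝ)
      simp only [one_div] at this
      exact this.comp hj
    refine h0.congr' ?_
    filter_upwards [hj.eventually_gt_atTop 0] with n hn
    rw [if_pos hn]
  · intro n V _ _ _ hV f hf
    by_cases hn : 0 < j n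
    · simp only [if_pos hn]
      have hlt : K (j n) < Module.finrank (ZMod p) V := by
        rw [hV]
        exact (Nat.le_mul_of_pos_left _ hn).trans_lt (hjK n hn)
      obtain ⟨W, hW, h, h1, h2, h3⟩ := hK (j n) V hlt f hf
      refine ⟨W, ?_, h, h1, h2, h3⟩
      rw [hV] at hW
      rw [sub_le_iff_le_add]
      exact_mod_cast hW
    · simp only [if_neg hn]
      refine ⟨⊥, by simp, fun _ ↦ 0, fun _ ↦ Or.inl rfl, fun _ _ _ ↦ rfl, ?_⟩
      refine ThreeAP.mean_le_one fun m ↦ ?_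
      rw [sub_zero, abs_of_nonneg (hf.1.1 m).1]
      exact (hf.1.1 m).2
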